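/- Let $p$ be an odd prime and let $f:\mathbb Z_p\to\mathbb Z_p$ be a $1$-Lipschitz function, that is, $|f(x)-f(y)|_p\le |x-y|_p$ for all $x,y\in\mathbb Z_p$. Let $(a_n)_{n\ge 0}$ be its Mahler coefficients: the unique sequence in $\mathbb Q_p$ with $a_n\to 0$ and $$f(x)=\sum_{n=0}^{\infty}a_n\binom{x}{n}\qquad\text{for all } x\in\mathbb Z_p .$$ Call $f$ uniformly differentiable modulo $p$ if there exist a positive integer $N$ and, for each $u\in\mathbb Z_p$, an element $\partial_1 f(u)\in\mathbb Q_p$ such that $$f(u+p^s h)\equiv f(u)+p^s h\,\partial_1 f(u)\pmod{p^{s+1}}$$ for all $u\in\mathbb Z_p$, all integers $s\ge N$ and all $h\in\mathbb Z_p$ (here $\partial_1 f(u)$ does not depend on $s$ and $h$, and $x\equiv y\pmod{p^{m}}$ means $x-y\in p^{m}\mathbb Z_p$); in this case let $N_1(f)$ be the smallest such $N$. Then $f$ is uniformly differentiable modulo $p$ with $N_1(f)=1$ if and only if both of the following conditions hold: (1) $a_{n_-+n_sp^s}\equiv 0\pmod{p^{s+1}}$ for all integers $s\ge 1$, $2\le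 n_s\le p-1$ and $0\le n_-<p^s$; (2) $a_{n_-+p^s}\equiv 0\pmod{p^{s+1}}$ for all integers $s\ge 2$ and $0\le n_-<p^s$. -/

import Mathlib

open Filter Topology

/-- Congruence `x ≡ y (mod p ^ m)` between `p`-adic numbers: `x - y ∈ p ^ m ℤ_p`. -/
def PadicModEq (p : ℕ) [Fact p.Prime] (m : ℕ) (x y : ℚ_[p]) : Prop :=
  ∃ z : ℤ_[p], x - y = (p : ℚ_[p]) ^ m * (z : ℚ_[p])

/-- The positive integer `N` witnesses uniform differentiability modulo `p ^ k` of `f`: for every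
`u` there is a value `∂ u = ∂ₖ f(u) ∈ ℚ_p`, independent of `s` and `h`, such that
`f (u + p ^ s h) ≡ f u + p ^ s h ∂ₖ f(u) (mod p ^ (k + s))` for all `s ≥ N` and all `h ∈ ℤ_p`. -/
def UnifDiffModWitness (p : ℕ) [Fact p.Prime] (k : ℕ) (f : ℤ_[p] → ℤ_[p]) (N : ℕ) : Prop :=
  0 < N ∧ ∃ D : ℤ_[p] → ℚ_[p], ∀ u : ℤ_[p], ∀ s : ℕ, N ≤ s → ∀ h : ℤ_[p],
    PadicModEq p (k + s) ((f (u + (p : ℤ_[p]) ^ s * h) : ℤ_[p]) : ℚ_[p])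
      ((f u : ℚ_[p]) + (p : ℚ_[p]) ^ s * (h : ℚ_[p]) * D u)

/-- `f : ℤ_p → ℤ_p` is uniformly differentiable modulo `p ^ k`. -/
def IsUnifDiffMod (p : ℕ) [Fact p.Prime] (k : ℕ) (f : ℤ_[p] → ℤ_[p]) : Prop :=
  ∃ N : ℕ, UnifDiffModWitness p k f N

/-- `N_k(f)`: the smallest positive integer witnessing uniform differentiability modulo `p ^ k`
(meaningful when `f` is uniformly differentiable modulo `p ^ k`). -/
noncomputable def unifDiffLevel (p : ℕ) [Fact p.Prime] (k : ℕ) (f : ℤ_[p] → ℤ_[p]) : ℕ :=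
  sInf {N : ℕ | UnifDiffModWitness p k f N}

/-- `a` is the sequence of Mahler coefficients of `f`: `a n → 0` in `ℚ_p` and
`f x = ∑ a n * (x choose n)` for all `x ∈ ℤ_p` (`mahler n` is the function `x ↦ (x choose n)`). -/
def IsMahlerCoeffs (p : ℕ) [Fact p.Prime] (f : ℤ_[p] → ℤ_[p]) (a : ℕ → ℚ_[p]) : Prop :=
  Tendsto a atTop (𝓝 0) ∧
    ∀ x : ℤ_[p], HasSum (fun n : ℕ => a n * ((mahler n x : ℤ_[p]) : ℚ_[p])) (f x : ℚ_[p])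

/-- A continuous function has exactly one sequence of Mahler coefficients. -/
theorem existsUnique_isMahlerCoeffs (p : ℕ) [Fact p.Prime] (f : ℤ_[p] → ℤ_[p])
    (hf : Continuous f) : ∃! a : ℕ → ℚ_[p], IsMahlerCoeffs p f a := by
  have : IsBoundedSMul ℤ_[p] ℚ_[p] := IsBoundedSMul.of_norm_smul_le fun r x => by
    simp [Algebra.smul_def]
  let g : C(ℤ_[p], ℚ_[p]) := ⟨fun x => (f x : ℚ_[p]), by fun_prop⟩
  have key : ∀ (a : ℕ → ℚ_[p]) (x : ℤ_[p]), Tendsto a atTop (𝓝 0) →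
      HasSum (fun n : ℕ => a n * ((mahler n x : ℤ_[p]) : ℚ_[p]))
        ((PadicInt.mahlerSeries a : C(ℤ_[p], ℚ_[p])) x) := by
    intro a x ha
    have h := ContinuousMap.hasSum_apply (PadicInt.hasSum_mahlerSeries (p := p) ha) x
    have e : (fun n : ℕ => a n * ((mahler n x : ℤ_[p]) : ℚ_[p])) =
        fun n => PadicInt.mahlerTerm (a n) n x := by
      funext n
      simp [PadicInt.mahlerTerm_apply, Algebra.smul_def, mul_comm]
    rw [e]
    exact h
  refine ⟨fun n => (fwdDiff 1)^[n] g 0, ⟨PadicInt.fwdDiff_tendsto_zero g, fun x => ?_⟩, ?_⟩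
  · have h := key _ x (PadicInt.fwdDiff_tendsto_zero g)
    have e := (PadicInt.hasSum_mahlerSeries (PadicInt.fwdDiff_tendsto_zero g)).unique
      (PadicInt.hasSum_mahler g)
    rwa [e] at h
  · rintro a ⟨ha, hs⟩
    have hg : (PadicInt.mahlerSeries a : C(ℤ_[p], ℚ_[p])) = g := by
      ext x
      exact (key a x ha).unique (hs x)
    funext n
    rw [← hg]
    exact (PadicInt.fwdDiff_mahlerSeries ha n).symm

/-! Both conditions together say that `p ^ (s + 1)` divides `a n` whenever `n ≥ 2p`, `n ≥ p ^ s` and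
`s ≥ 1`.

Necessity: a derivative modulo `p` depends only on residues mod `p`. Subtracting from `f` its
interpolating Mahler polynomial of degree `< p`, then a combination of `p * mahler (p + m)` with `m
< p`, whose derivative mod `p` is `mahler m`, leaves `g` with values and derivative divisible by `p`
(`HasDerivModP.pow_dvd_fwdDiff_iter`). Then `g / p` is Lipschitz along shifts by `p ^ t`, so its
coefficients of index `≥ p ^ s` are divisible by `p ^ s` (`PadicInt.pow_dvd_fwdDiff_iter`), while
those of `f` and `g` agree from index `2p` on.

Sufficiency: the terms below `2p` are differentiable mod `p`, and the tail has derivative `0`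
(`exists_hasDerivModP_of_dvd`). -/

open scoped Polynomial

/-! ### Iterated differences of Lipschitz functions -/

/-- In a commutative ring, `(x - 1) ^ (p ^ s)` is a combination of the elements
`p ^ i * (x ^ (p ^ j) - 1)` with `i + j = s`. -/
theorem sub_one_pow_prime_pow_mem_span {R : Type*} [CommRing R] {p : ℕ} (hp : p.Prime) (x : R)
    (s : ℕ) : (x - 1) ^ p ^ s ∈ Ideal.span
      {y : R | ∃ i j : ℕ, i + j = s ∧ y = (p : R) ^ i * (x ^ p ^ j - 1)} := by
  induction s with
  | zero => exact Ideal.subset_span ⟨0, 0, rfl, by simp⟩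
  | succ s ih =>
    have hle : p ^ s ≤ p ^ (s + 1) := Nat.pow_le_pow_right hp.pos s.le_succ
    rw [← Nat.add_sub_cancel' hle, pow_add]
    refine Submodule.span_induction (p := fun y _ => y * (x - 1) ^ (p ^ (s + 1) - p ^ s) ∈
      Ideal.span {y : R | ∃ i j : ℕ, i + j = s + 1 ∧ y = (p : R) ^ i * (x ^ p ^ j - 1)})
      ?_ (by simp) (fun y z _ _ hy hz => by rw [add_mul]; exact add_mem hy hz)
      (fun r y _ hy => by rw [smul_eq_mul, mul_assoc]; exact Ideal.mul_mem_left _ _ hy) ih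
    rintro _ ⟨i, j, rfl, rfl⟩
    have hexp : p ^ j * (p - 1) ≤ p ^ (i + j + 1) - p ^ (i + j) := by
      rw [pow_succ, ← Nat.mul_sub_one]
      exact Nat.mul_le_mul_right _ (Nat.pow_le_pow_right hp.pos (by omega))
    rw [← Nat.add_sub_cancel' hexp, pow_add, ← mul_assoc]
    refine Ideal.mul_mem_right _ _ ?_
    -- With `y = x ^ p ^ j - 1`: mod `p`, `(x - 1) ^ (p ^ j * (p - 1))` is `y ^ (p - 1)`, and `y ^
    -- p` is `x ^ p ^ (j + 1) - 1` up to a multiple of `p * y`.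
    obtain ⟨r, hr⟩ := exists_add_pow_prime_pow_eq hp (x - 1) 1 j
    obtain ⟨q, hq⟩ := exists_add_pow_prime_eq hp (x ^ p ^ j - 1) 1
    rw [sub_add_cancel, one_pow] at hr hq
    obtain ⟨c, hc⟩ : (p : R) ∣ (x - 1) ^ (p ^ j * (p - 1)) - (x ^ p ^ j - 1) ^ (p - 1) := by
      rw [pow_mul]
      refine dvd_trans ⟨-((x - 1) * r), ?_⟩ (sub_dvd_pow_sub_pow _ _ _)
      rw [hr]; ring
    have hsplit : (p : R) ^ i * (x ^ p ^ j - 1) * (x - 1) ^ (p ^ j * (p - 1)) =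
        (p : R) ^ i * (x ^ p ^ (j + 1) - 1) +
          (c - q) * ((p : R) ^ (i + 1) * (x ^ p ^ j - 1)) := by
      have hpow : (x ^ p ^ j - 1) ^ p = (x ^ p ^ j - 1) ^ (p - 1) * (x ^ p ^ j - 1) := by
        rw [← pow_succ, Nat.sub_add_cancel hp.one_le]
      rw [pow_succ p j, pow_mul x (p ^ j) p, hq, hpow, eq_add_of_sub_eq hc]
      ring
    rw [hsplit]
    exact add_mem (Ideal.subset_span ⟨i, j + 1, by omega, rfl⟩)
      (Ideal.mul_mem_left _ _ (Ideal.subset_span ⟨i + 1, j, by omega, rfl⟩))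

theorem fwdDiff_iter_eq_aeval {M G : Type*} [AddCommMonoid M] [AddCommGroup G] (h : M)
    (f : M → G) (n : ℕ) :
    (fwdDiff h)^[n] f = Polynomial.aeval (fwdDiff_aux.shiftₗ M G h) ((Polynomial.X - 1 : ℤ[X]) ^ n) f := by
  rw [map_pow, map_sub, Polynomial.aeval_X, map_one, fwdDiff_aux.shiftₗ, add_sub_cancel_right,
    fwdDiff_aux.coe_fwdDiffₗ_pow]

section

variable {p : ℕ} [Fact p.Prime]

/-- The iterated forward differences of order `n ≥ p ^ s` of a function which is `1`-Lipschitz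
along the shifts by powers of `p` are divisible by `p ^ s`. -/
theorem PadicInt.pow_dvd_fwdDiff_iter {f : ℤ_[p] → ℤ_[p]}
    (hf : ∀ (t : ℕ) (x : ℤ_[p]), (p : ℤ_[p]) ^ t ∣ f (x + (p : ℤ_[p]) ^ t) - f x)
    {s n : ℕ} (hn : p ^ s ≤ n) (x : ℤ_[p]) : (p : ℤ_[p]) ^ s ∣ (fwdDiff 1)^[n] f x := by
  let E := fwdDiff_aux.shiftₗ ℤ_[p] ℤ_[p] 1
  let S : Submodule ℤ (ℤ_[p] → ℤ_[p]) :=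
    { carrier := {g | ∀ x, (p : ℤ_[p]) ^ s ∣ g x}
      add_mem' := fun ha hb x => dvd_add (ha x) (hb x)
      zero_mem' := fun x => dvd_zero _
      smul_mem' := fun c g hg x => by
        rw [Pi.smul_apply, zsmul_eq_mul]; exact (hg x).mul_left _ }
  have hES : ∀ g ∈ S, E g ∈ S := fun g hg x => by
    rw [fwdDiff_aux.shiftₗ_apply]; exact hg _
  have hPS : ∀ (P : ℤ[X]), ∀ g ∈ S, Polynomial.aeval E P g ∈ S := by
    intro P g hg
    induction P using Polynomial.induction_on' with
    | add P Q hP hQ => rw [map_add]; exact S.add_mem hP hQ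
    | monomial m c =>
      rw [Polynomial.aeval_monomial, Module.End.mul_apply]
      have : (E ^ m) g ∈ S := by
        intro x
        rw [fwdDiff_aux.shiftₗ_pow_apply]; exact hg _
      rw [Module.algebraMap_end_apply]
      exact S.smul_mem c this
  have key : ∀ P ∈ Ideal.span {y : ℤ[X] | ∃ i j : ℕ, i + j = s ∧
      y = (p : ℤ[X]) ^ i * (Polynomial.X ^ p ^ j - 1)}, Polynomial.aeval E P f ∈ S := by
    intro P hP
    induction hP using Submodule.span_induction with
    | mem P hP =>
      obtain ⟨i, j, rfl, rfl⟩ := hP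
      intro x
      have h := mul_dvd_mul_left ((p : ℤ_[p]) ^ i) (hf j x)
      rw [← pow_add] at h
      convert h using 1
      rw [map_mul, map_sub, map_pow, map_pow, map_one, Polynomial.aeval_X, map_natCast,
        ← Nat.cast_pow, Module.End.mul_apply, Module.End.natCast_apply, Pi.smul_apply,
        LinearMap.sub_apply, Pi.sub_apply, fwdDiff_aux.shiftₗ_pow_apply, nsmul_eq_mul]
      simp
    | zero => rw [map_zero]; exact S.zero_mem
    | add P Q _ _ hP hQ => rw [map_add]; exact S.add_mem hP hQ
    | smul Q P _ hP =>
      rw [smul_eq_mul, map_mul, Module.End.mul_apply]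
      exact hPS Q _ hP
  rw [fwdDiff_iter_eq_aeval, ← Nat.sub_add_cancel hn, pow_add, map_mul, Module.End.mul_apply]
  exact hPS _ _ (key _ (sub_one_pow_prime_pow_mem_span Fact.out _ s)) x

/-! ### Increments of Mahler polynomials -/

theorem fwdDiff_iter_mahler_zero (n j : ℕ) :
    (fwdDiff 1)^[n] (mahler j : ℤ_[p] → ℤ_[p]) 0 = if n = j then 1 else 0 := by
  have h := congrArg (Int.cast : ℤ → ℤ_[p]) (fwdDiff_iter_choose_zero j n)
  rw [fwdDiff_iter_eq_sum_shift] at h ⊢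
  simpa [mahler_natCast_eq] using h

/-- Newton's interpolation formula at the natural numbers below `N`. -/
theorem apply_natCast_eq_sum_mahler (F : ℤ_[p] → ℤ_[p]) {k N : ℕ} (hk : k < N) :
    F k = ∑ j ∈ Finset.range N, (fwdDiff 1)^[j] F 0 * mahler j (k : ℤ_[p]) := by
  have h := shift_eq_sum_fwdDiff_iter 1 F k 0
  rw [zero_add, nsmul_one] at h
  rw [h]
  simp only [mahler_natCast_eq, nsmul_eq_mul]
  rw [← Finset.sum_subset (Finset.range_subset_range.2 (Nat.succ_le_of_lt hk))]
  · exact Finset.sum_congr rfl fun _ _ => mul_comm _ _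
  · intro j _ hj
    rw [Nat.choose_eq_zero_of_lt (by simpa using hj)]
    simp

theorem PadicInt.succ_mul_choose_succ (z : ℤ_[p]) (j : ℕ) :
    ((j + 1 : ℕ) : ℤ_[p]) * Ring.choose z (j + 1) = z * Ring.choose (z - 1) j := by
  have h := Ring.choose_smul_choose z (n := j + 1) (k := 1) (by omega)
  simpa using h

/-- The bound on `j` forces its `p`-adic valuation to be at most `s`. -/
theorem PadicInt.pow_dvd_of_pow_dvd_natCast_mul {j s t : ℕ} (hj : 0 < j) (hjs : j < p ^ (s + 1))
    {y : ℤ_[p]} (h : (p : ℤ_[p]) ^ t ∣ j * y) : (p : ℤ_[p]) ^ t ∣ (p : ℤ_[p]) ^ s * y := by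
  have hp : p.Prime := Fact.out
  obtain ⟨v, m, hm, rfl⟩ := Nat.exists_eq_pow_mul_and_not_dvd hj.ne' p hp.ne_one
  have hv : v ≤ s := by
    by_contra! hv
    exact absurd (Nat.le_of_dvd hj ((pow_dvd_pow p hv).mul_right m)) (not_le.2 hjs)
  have hu : IsUnit (m : ℤ_[p]) := by
    rw [PadicInt.isUnit_iff]
    exact PadicInt.norm_natCast_eq_one_iff.2 ((Nat.Prime.coprime_iff_not_dvd hp).2 hm)
  have h' : (p : ℤ_[p]) ^ t ∣ (p : ℤ_[p]) ^ v * y := by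
    rw [← hu.dvd_mul_left]
    convert h using 1
    push_cast; ring
  exact h'.trans (mul_dvd_mul_right (pow_dvd_pow _ hv) _)

theorem PadicInt.pow_dvd_pow_mul_choose {j s t : ℕ} (hj : 0 < j) (hjs : j < p ^ (s + 1))
    {z : ℤ_[p]} (hz : (p : ℤ_[p]) ^ t ∣ z) : (p : ℤ_[p]) ^ t ∣ (p : ℤ_[p]) ^ s * Ring.choose z j := by
  refine pow_dvd_of_pow_dvd_natCast_mul hj hjs ?_
  obtain ⟨j, rfl⟩ := Nat.exists_eq_succ_of_ne_zero hj.ne'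
  rw [Nat.succ_eq_add_one, succ_mul_choose_succ]
  exact hz.mul_right _

theorem mahler_add_sub (n : ℕ) (x z : ℤ_[p]) :
    mahler n (x + z) - mahler n x =
      ∑ j ∈ Finset.range n, Ring.choose z (j + 1) * mahler (n - (j + 1)) x := by
  simp only [mahler_apply]
  rw [add_comm x z, Ring.add_choose_eq n (Commute.all z x),
    Finset.Nat.sum_antidiagonal_eq_sum_range_succ
      (fun i j => Ring.choose z i * Ring.choose x j), Finset.sum_range_succ']
  simp

theorem pow_dvd_pow_mul_mahler_add_sub {n s t : ℕ} (hn : n < p ^ (s + 1)) (x : ℤ_[p])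
    {z : ℤ_[p]} (hz : (p : ℤ_[p]) ^ t ∣ z) :
    (p : ℤ_[p]) ^ t ∣ (p : ℤ_[p]) ^ s * (mahler n (x + z) - mahler n x) := by
  rw [mahler_add_sub, Finset.mul_sum]
  refine Finset.dvd_sum fun j hj => ?_
  rw [← mul_assoc]
  have := Finset.mem_range.1 hj
  exact (PadicInt.pow_dvd_pow_mul_choose j.succ_pos (by omega) hz).mul_right _

/-! ### Derivatives modulo p -/

/-- `D` is a derivative of `f` modulo `p`, at all scales `p ^ s` with `s ≥ 1`. -/
def HasDerivModP (f D : ℤ_[p] → ℤ_[p]) : Prop :=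
  ∀ (s : ℕ), 1 ≤ s → ∀ u z : ℤ_[p], (p : ℤ_[p]) ^ s ∣ z →
    (p : ℤ_[p]) ^ (s + 1) ∣ f (u + z) - f u - z * D u

namespace HasDerivModP

variable {f g D E : ℤ_[p] → ℤ_[p]}

theorem add (hf : HasDerivModP f D) (hg : HasDerivModP g E) :
    HasDerivModP (fun x => f x + g x) (fun x => D x + E x) := fun s hs u z hz => by
  convert dvd_add (hf s hs u z hz) (hg s hs u z hz) using 1
  ring

theorem const_mul (c : ℤ_[p]) (hf : HasDerivModP f D) :
    HasDerivModP (fun x => c * f x) (fun x => c * D x) := fun s hs u z hz => by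
  convert (hf s hs u z hz).mul_left c using 1
  ring

theorem sub (hf : HasDerivModP f D) (hg : HasDerivModP g E) :
    HasDerivModP (fun x => f x - g x) (fun x => D x - E x) := fun s hs u z hz => by
  convert dvd_sub (hf s hs u z hz) (hg s hs u z hz) using 1
  ring

theorem sum {ι : Type*} (S : Finset ι) {F G : ι → ℤ_[p] → ℤ_[p]}
    (h : ∀ i ∈ S, HasDerivModP (F i) (G i)) :
    HasDerivModP (fun x => ∑ i ∈ S, F i x) (fun x => ∑ i ∈ S, G i x) := fun s hs u z hz => by
  convert Finset.dvd_sum fun i hi => h i hi s hs u z hz using 1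
  simp only [Finset.sum_sub_distrib, Finset.mul_sum]

/-- A derivative modulo `p` depends only on the residue class modulo `p`. -/
theorem dvd_deriv_add_sub (hf : HasDerivModP f D) (u : ℤ_[p]) {z : ℤ_[p]}
    (hz : (p : ℤ_[p]) ∣ z) : (p : ℤ_[p]) ∣ D (u + z) - D u := by
  -- The increment from `u` to `u + z + p` is computed directly and through `u + z`.
  have h1 := hf 1 le_rfl u (z + p) (by simpa using hz)
  have h2 := hf 1 le_rfl u z (by simpa using hz)
  have h3 := hf 1 le_rfl (u + z) p (by simp)
  have hp : (p : ℤ_[p]) ≠ 0 := Nat.cast_ne_zero.2 (Fact.out : p.Prime).ne_zero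
  rw [← mul_dvd_mul_iff_left hp, ← pow_two]
  convert dvd_sub (dvd_sub h1 h2) h3 using 1
  rw [add_assoc]
  ring

end HasDerivModP

theorem PadicInt.isUnit_natCast {n : ℕ} (hn : ¬ p ∣ n) : IsUnit (n : ℤ_[p]) := by
  rw [PadicInt.isUnit_iff]
  exact PadicInt.norm_natCast_eq_one_iff.2 ((Nat.Prime.coprime_iff_not_dvd Fact.out).2 hn)

theorem PadicInt.dvd_choose_add_sub_choose {j : ℕ} (hj : j < p) (x : ℤ_[p]) {z : ℤ_[p]}
    (hz : (p : ℤ_[p]) ∣ z) : (p : ℤ_[p]) ∣ Ring.choose (x + z) j - Ring.choose x j := by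
  have h := pow_dvd_pow_mul_mahler_add_sub (n := j) (s := 0) (t := 1) (by simpa using hj) x
    (by simpa using hz)
  rwa [pow_one, pow_zero, one_mul] at h

/-- For `j + 1 < p + 1`, the Vandermonde coefficient `choose z (j + 1)` is `z / (j + 1) * choose (z
- 1) j`; here `j + 1` is a unit and `choose (z - 1) j ≡ choose (-1) j` mod `p`. -/
theorem hasDerivModP_mahler {n : ℕ} (hn : n < p) :
    ∃ D, HasDerivModP (p := p) (mahler n) D := by
  have hu : ∀ j < n, ∃ c : ℤ_[p], ((j + 1 : ℕ) : ℤ_[p]) * c = 1 := fun j hj => by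
    exact (PadicInt.isUnit_natCast (Nat.not_dvd_of_pos_of_lt j.succ_pos (by omega))).exists_right_inv
  choose! c hc using hu
  refine ⟨fun x => ∑ j ∈ Finset.range n,
    c j * Ring.choose (-1 : ℤ_[p]) j * mahler (n - (j + 1)) x, fun s hs u z hz => ?_⟩
  rw [mahler_add_sub, Finset.mul_sum, ← Finset.sum_sub_distrib]
  refine Finset.dvd_sum fun j hj => ?_
  have hj := Finset.mem_range.1 hj
  have h1 := PadicInt.dvd_choose_add_sub_choose (by omega : j < p) (-1)
    ((dvd_pow_self _ (by omega)).trans hz)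
  have h2 := (mul_dvd_mul hz h1).mul_left (c j)
  rw [← pow_succ] at h2
  convert h2.mul_right (mahler (n - (j + 1)) u) using 1
  have h3 := PadicInt.succ_mul_choose_succ z j
  have h4 : Ring.choose z (j + 1) = c j * (z * Ring.choose (z - 1) j) := by
    rw [← h3, ← mul_assoc, mul_comm (c j), hc j hj, one_mul]
  rw [h4, neg_add_eq_sub]
  ring

/-- Only the Vandermonde term of order `p` has a denominator divisible by `p`, and `p * choose z p =
z * choose (z - 1) (p - 1) ≡ z` modulo `p * z`, up to a `p`-integral factor. All other terms are
killed by the factor `p`. -/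
theorem hasDerivModP_prime_mul_mahler {m : ℕ} (hm : m < p) :
    HasDerivModP (p := p) (fun x => p * mahler (p + m) x) (mahler m) := by
  intro s hs u z hz
  have hp : p.Prime := Fact.out
  have hpp : p + m < p ^ (1 + 1) := by
    rw [pow_succ, pow_one]; nlinarith [hp.two_le]
  rw [← mul_sub, mahler_add_sub, Finset.mul_sum,
    ← Finset.add_sum_erase _ _ (Finset.mem_range.2 (by have := hp.pos; omega : p - 1 < p + m)),
    add_sub_right_comm]
  have hp1 : p - 1 + 1 = p := Nat.sub_add_cancel hp.one_le
  refine dvd_add ?_ (Finset.dvd_sum fun j hj => ?_)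
  · rw [hp1, Nat.add_sub_cancel_left, ← mul_assoc]
    have h := PadicInt.succ_mul_choose_succ z (p - 1)
    rw [hp1] at h
    rw [h, ← sub_mul, ← mul_sub_one, pow_succ]
    refine (mul_dvd_mul hz ?_).mul_right _
    have h1 := PadicInt.dvd_choose_add_sub_choose (by have := hp.pos; omega : p - 1 < p)
      ((p - 1 : ℕ) : ℤ_[p]) (z := z - p)
      (dvd_sub_self_right.2 ((dvd_pow_self _ (by omega)).trans hz))
    rw [Ring.choose_natCast, Nat.choose_self, Nat.cast_one, Nat.cast_sub hp.one_le] at h1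
    convert h1 using 3
    push_cast; ring
  · have hj' := Finset.mem_erase.1 hj
    have hjm := Finset.mem_range.1 hj'.2
    rw [pow_succ']
    refine mul_dvd_mul_left _ (Dvd.dvd.mul_right ?_ _)
    have hu : IsUnit ((j + 1 : ℕ) : ℤ_[p]) := by
      refine PadicInt.isUnit_natCast ?_
      rintro ⟨k, hk⟩
      have hk2 : k < 2 := by
        by_contra! h
        have := Nat.mul_le_mul_left p h
        omega
      interval_cases k <;> omega
    rw [← hu.dvd_mul_left, PadicInt.succ_mul_choose_succ]
    exact hz.mul_right _

/-! ### Coefficient divisibility versus differentiability -/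

theorem PadicInt.dvd_of_hasSum {F : ℕ → ℤ_[p]} {y : ℤ_[p]} (h : HasSum F y) {t : ℕ}
    (hF : ∀ n, (p : ℤ_[p]) ^ t ∣ F n) : (p : ℤ_[p]) ^ t ∣ y := by
  choose G hG using hF
  have hc : IsClosed {x : ℤ_[p] | (p : ℤ_[p]) ^ t ∣ x} := by
    have : {x : ℤ_[p] | (p : ℤ_[p]) ^ t ∣ x} =
        Metric.closedBall 0 ((p : ℝ) ^ (-t : ℤ)) := by
      ext x
      rw [Set.mem_ofPred_eq, mem_closedBall_zero_iff, PadicInt.norm_le_pow_iff_mem_span_pow,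
        Ideal.mem_span_singleton]
    rw [this]
    exact Metric.isClosed_closedBall
  exact hc.mem_of_tendsto h (Eventually.of_forall fun S => Finset.dvd_sum fun n _ => ⟨G n, hG n⟩)

theorem exists_hasDerivModP_of_dvd {f : ℤ_[p] → ℤ_[p]} {b : ℕ → ℤ_[p]}
    (hb : ∀ x, HasSum (fun n => b n * mahler n x) (f x))
    (h : ∀ s n : ℕ, 1 ≤ s → 2 * p ≤ n → p ^ s ≤ n → (p : ℤ_[p]) ^ (s + 1) ∣ b n)
    (h1 : ∀ n, p ≤ n → (p : ℤ_[p]) ∣ b n) : ∃ D, HasDerivModP f D := by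
  have hp : p.Prime := Fact.out
  have hfin : ∀ n ∈ Finset.range (2 * p),
      ∃ D, HasDerivModP (fun x => b n * mahler n x) D := by
    intro n hn
    have hn := Finset.mem_range.1 hn
    rcases lt_or_ge n p with hnp | hnp
    · obtain ⟨D, hD⟩ := hasDerivModP_mahler hnp
      exact ⟨_, hD.const_mul (b n)⟩
    · obtain ⟨m, rfl⟩ := Nat.exists_eq_add_of_le hnp
      obtain ⟨c, hc⟩ := h1 _ hnp
      have := (hasDerivModP_prime_mul_mahler (p := p) (m := m) (by omega)).const_mul c
      refine ⟨fun x => c * mahler m x, ?_⟩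
      convert this using 2 with x
      rw [hc]; ring
  choose! D hD using hfin
  have htail : HasDerivModP (fun x => f x - ∑ n ∈ Finset.range (2 * p), b n * mahler n x)
      (fun _ => 0) := by
    intro s hs u z hz
    have hsum : ∀ x, HasSum (fun n => b (n + 2 * p) * mahler (n + 2 * p) x)
        (f x - ∑ n ∈ Finset.range (2 * p), b n * mahler n x) := fun x =>
      (hasSum_nat_add_iff' (f := fun n => b n * mahler n x) (2 * p)).2 (hb x)
    have := (hsum (u + z)).sub (hsum u)
    rw [mul_zero, sub_zero]
    refine PadicInt.dvd_of_hasSum this fun n => ?_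
    have hn0 : n + 2 * p ≠ 0 := by have := hp.pos; omega
    -- With `t = Nat.log p (n + 2 * p)`, the coefficient supplies `p ^ (t + 1)`; `p ^ t` absorbs the
    -- denominators and one factor `p` remains.
    have hlog : 1 ≤ Nat.log p (n + 2 * p) := Nat.log_pos hp.one_lt (by omega)
    obtain ⟨c, hc⟩ := h _ (n + 2 * p) hlog (by omega) (Nat.pow_log_le_self p hn0)
    have hd := pow_dvd_pow_mul_mahler_add_sub (p := p) (Nat.lt_pow_succ_log_self hp.one_lt
      (n + 2 * p)) u hz
    rw [← mul_sub, hc, pow_succ' _ s, pow_succ']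
    refine dvd_trans (mul_dvd_mul_left _ hd) ⟨c, ?_⟩
    ring
  have := htail.add (HasDerivModP.sum _ hD)
  simp only [sub_add_cancel] at this
  exact ⟨_, this⟩

theorem HasDerivModP.pow_dvd_fwdDiff_iter {f D : ℤ_[p] → ℤ_[p]} (hf : HasDerivModP f D)
    {s n : ℕ} (hn : 2 * p ≤ n) (hs : p ^ s ≤ n) :
    (p : ℤ_[p]) ^ (s + 1) ∣ (fwdDiff 1)^[n] f 0 := by
  have hp : p.Prime := Fact.out
  have hp0 : (p : ℤ_[p]) ≠ 0 := Nat.cast_ne_zero.2 hp.ne_zero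
  choose! C hC using fun n (hn : n ∈ Finset.range p) =>
    hasDerivModP_mahler (p := p) (Finset.mem_range.1 hn)
  let P : ℤ_[p] → ℤ_[p] := fun x => ∑ j ∈ Finset.range p, (fwdDiff 1)^[j] f 0 * mahler j x
  let D₁ : ℤ_[p] → ℤ_[p] := fun x =>
    D x - ∑ j ∈ Finset.range p, (fwdDiff 1)^[j] f 0 * C j x
  have h1 : HasDerivModP (fun x => f x - P x) D₁ :=
    hf.sub (HasDerivModP.sum _ fun j hj => (hC j hj).const_mul _)
  let Q : ℤ_[p] → ℤ_[p] := fun x =>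
    ∑ m ∈ Finset.range p, (fwdDiff 1)^[m] D₁ 0 * (p * mahler (p + m) x)
  let D₂ : ℤ_[p] → ℤ_[p] := fun x =>
    D₁ x - ∑ m ∈ Finset.range p, (fwdDiff 1)^[m] D₁ 0 * mahler m x
  let g : ℤ_[p] → ℤ_[p] := fun x => f x - P x - Q x
  have h2 : HasDerivModP g D₂ := h1.sub (HasDerivModP.sum _ fun m hm =>
    (hasDerivModP_prime_mul_mahler (Finset.mem_range.1 hm)).const_mul _)
  have hres : ∀ x : ℤ_[p], ∃ k < p, ∃ z, (p : ℤ_[p]) ∣ z ∧ x = (k : ℤ_[p]) + z := fun x =>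
    ⟨x.zmodRepr, PadicInt.zmodRepr_lt_p x, x - x.zmodRepr,
      (PadicInt.norm_lt_one_iff_dvd _).1 x.norm_sub_zmodRepr_lt_one, by ring⟩
  have hD₂ : ∀ x, (p : ℤ_[p]) ∣ D₂ x := fun x => by
    obtain ⟨k, hk, z, hz, rfl⟩ := hres x
    have h0 : D₂ k = 0 := sub_eq_zero.2 (apply_natCast_eq_sum_mahler D₁ hk)
    simpa [h0] using h2.dvd_deriv_add_sub k hz
  have hg2 : ∀ (t : ℕ), 1 ≤ t → ∀ u z : ℤ_[p], (p : ℤ_[p]) ^ t ∣ z →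
      (p : ℤ_[p]) ^ (t + 1) ∣ g (u + z) - g u := fun t ht u z hz => by
    have := h2 t ht u z hz
    refine (dvd_sub_left ?_).1 this
    rw [pow_succ]
    exact mul_dvd_mul hz (hD₂ u)
  have hg : ∀ x, (p : ℤ_[p]) ∣ g x := fun x => by
    obtain ⟨k, hk, z, hz, rfl⟩ := hres x
    have h0 : g k = 0 := by
      have hP : f k - P k = 0 := sub_eq_zero.2 (apply_natCast_eq_sum_mahler f hk)
      have hQ : Q k = 0 := Finset.sum_eq_zero fun m _ => by
        rw [mahler_natCast_eq, Nat.choose_eq_zero_of_lt (by omega)]; simp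
      simp only [g, hP, hQ, sub_zero]
    have := hg2 1 le_rfl k z (by simpa using hz)
    rw [h0, sub_zero] at this
    exact (dvd_pow_self _ (by omega)).trans this
  choose k hk using hg
  have hgk : g = (p : ℤ_[p]) • k := funext hk
  -- Dividing by `p` costs one power, which the vanishing derivative of `g` repays; scale `t = 0` is
  -- trivial.
  have hkL : ∀ (t : ℕ) (x : ℤ_[p]), (p : ℤ_[p]) ^ t ∣ k (x + (p : ℤ_[p]) ^ t) - k x := by
    intro t x
    rcases Nat.eq_zero_or_pos t with rfl | ht
    · simp
    · have := hg2 t ht x _ dvd_rfl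
      rw [hk, hk, ← mul_sub, pow_succ'] at this
      exact (mul_dvd_mul_iff_left hp0).1 this
  have hfg : f = g + ((∑ j ∈ Finset.range p, (fwdDiff 1)^[j] f 0 • ⇑(mahler j)) +
      ∑ m ∈ Finset.range p, ((fwdDiff 1)^[m] D₁ 0 * p) • ⇑(mahler (p + m))) := by
    funext x
    simp only [g, P, Q, Pi.add_apply, Finset.sum_apply, Pi.smul_apply, smul_eq_mul, mul_assoc]
    ring
  have hvan : ∀ {j : ℕ}, j < n → (fwdDiff 1)^[n] (mahler j : ℤ_[p] → ℤ_[p]) 0 = 0 :=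
    fun hj => by rw [fwdDiff_iter_mahler_zero, if_neg (by omega)]
  have hfn : (fwdDiff 1)^[n] f 0 = (p : ℤ_[p]) * (fwdDiff 1)^[n] k 0 := by
    conv_lhs => rw [hfg]
    rw [fwdDiff_iter_add, fwdDiff_iter_add, fwdDiff_iter_finsetSum, fwdDiff_iter_finsetSum, hgk]
    simp only [fwdDiff_iter_const_smul, Pi.add_apply, Finset.sum_apply, Pi.smul_apply, smul_eq_mul]
    rw [Finset.sum_eq_zero fun j hj => ?_, Finset.sum_eq_zero fun j hj => ?_, add_zero, add_zero]
    · rw [hvan (by have := Finset.mem_range.1 hj; omega), mul_zero]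
    · rw [hvan (by have := Finset.mem_range.1 hj; omega), mul_zero]
  rw [hfn, pow_succ']
  exact mul_dvd_mul_left _ (PadicInt.pow_dvd_fwdDiff_iter hkL hs 0)

/-! ### Passage to ℚ_p and conclusion -/

theorem padicModEq_coe_iff {m : ℕ} {x y : ℤ_[p]} :
    PadicModEq p m (x : ℚ_[p]) (y : ℚ_[p]) ↔ (p : ℤ_[p]) ^ m ∣ x - y :=
  exists_congr fun z => by
    exact ⟨fun h => PadicInt.ext (by push_cast; exact h),
      fun h => by simpa using congrArg (Subtype.val : ℤ_[p] → ℚ_[p]) h⟩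

theorem pow_dvd_sub_of_lipschitzWith {f : ℤ_[p] → ℤ_[p]} (hf : LipschitzWith 1 f) (u : ℤ_[p])
    {t : ℕ} {z : ℤ_[p]} (hz : (p : ℤ_[p]) ^ t ∣ z) : (p : ℤ_[p]) ^ t ∣ f (u + z) - f u := by
  rw [← Ideal.mem_span_singleton, ← PadicInt.norm_le_pow_iff_mem_span_pow] at hz ⊢
  refine le_trans ?_ hz
  simpa [dist_eq_norm] using hf.dist_le_mul (u + z) u

theorem unifDiffModWitness_one_iff {f : ℤ_[p] → ℤ_[p]} (hf : LipschitzWith 1 f) :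
    UnifDiffModWitness p 1 f 1 ↔ ∃ D, HasDerivModP f D := by
  have hp0 : (p : ℚ_[p]) ≠ 0 := Nat.cast_ne_zero.2 (Fact.out : p.Prime).ne_zero
  constructor
  · rintro ⟨-, D, hD⟩
    -- The derivative is integral: by the Lipschitz bound `p` divides `f (u + p) - f u`, which is `p
    -- * D u` mod `p ^ 2`.
    have hint : ∀ u, ∃ d : ℤ_[p], (d : ℚ_[p]) = D u := fun u => by
      obtain ⟨z, hz⟩ := hD u 1 le_rfl 1
      obtain ⟨w, hw⟩ := pow_dvd_sub_of_lipschitzWith hf u (t := 1) (z := (p : ℤ_[p]) ^ 1 * 1)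
        (by simp)
      have hw' := congrArg (fun x : ℤ_[p] => (x : ℚ_[p])) hw
      refine ⟨w - p * z, mul_left_cancel₀ hp0 ?_⟩
      push_cast at hz hw' ⊢
      linear_combination -hw' + hz
    choose d hd using hint
    refine ⟨d, fun s hs u z hz => ?_⟩
    obtain ⟨h, rfl⟩ := hz
    have := hD u s hs h
    rw [← hd u, add_comm 1 s] at this
    rw [sub_sub, ← padicModEq_coe_iff]
    exact_mod_cast this
  · rintro ⟨D, hD⟩
    refine ⟨one_pos, fun u => D u, fun u s hs h => ?_⟩
    have := hD s hs u _ (dvd_mul_right _ h)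
    rw [sub_sub, ← padicModEq_coe_iff] at this
    rw [add_comm 1 s]
    exact_mod_cast this

theorem isUnifDiffMod_and_level_eq_one_iff {k : ℕ} {f : ℤ_[p] → ℤ_[p]} :
    (IsUnifDiffMod p k f ∧ unifDiffLevel p k f = 1) ↔ UnifDiffModWitness p k f 1 := by
  constructor
  · rintro ⟨h, h1⟩
    have := Nat.sInf_mem (s := {N : ℕ | UnifDiffModWitness p k f N}) h
    change UnifDiffModWitness p k f (unifDiffLevel p k f) at this
    rwa [h1] at this
  · intro h
    refine ⟨⟨1, h⟩, le_antisymm (Nat.sInf_le h) ?_⟩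
    exact (Nat.sInf_mem (s := {N : ℕ | UnifDiffModWitness p k f N}) ⟨1, h⟩).1

theorem IsMahlerCoeffs.eq_fwdDiff_iter {f : ℤ_[p] → ℤ_[p]} (hf : Continuous f) {a : ℕ → ℚ_[p]}
    (ha : IsMahlerCoeffs p f a) (n : ℕ) : a n = ((fwdDiff 1)^[n] f 0 : ℤ_[p]) := by
  let F : C(ℤ_[p], ℤ_[p]) := ⟨f, hf⟩
  refine congrFun (g := fun n => (((fwdDiff 1)^[n] f 0 : ℤ_[p]) : ℚ_[p]))
    ((existsUnique_isMahlerCoeffs p f hf).unique ha ?_) n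
  constructor
  · exact (continuous_subtype_val.tendsto' (0 : ℤ_[p]) (0 : ℚ_[p]) rfl).comp (PadicInt.fwdDiff_tendsto_zero F)
  · intro x
    have h := ContinuousMap.hasSum_apply (PadicInt.hasSum_mahler F) x
    have h' := h.map PadicInt.Coe.ringHom continuous_subtype_val
    refine (h'.congr_fun fun n => ?_)
    rw [Function.comp_apply, PadicInt.mahlerTerm_apply, smul_eq_mul, map_mul, mul_comm]
    rfl

theorem hasSum_fwdDiff_iter_mul_mahler {f : ℤ_[p] → ℤ_[p]} (hf : Continuous f) (x : ℤ_[p]) :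
    HasSum (fun n => (fwdDiff 1)^[n] f 0 * mahler n x) (f x) := by
  let F : C(ℤ_[p], ℤ_[p]) := ⟨f, hf⟩
  have h := ContinuousMap.hasSum_apply (PadicInt.hasSum_mahler F) x
  simp only [PadicInt.mahlerTerm_apply, smul_eq_mul] at h
  simp only [mul_comm]
  exact h

end

theorem theorem3p5 (p : ℕ) [Fact p.Prime] (hp : Odd p) (f : ℤ_[p] → ℤ_[p])
    (hf : LipschitzWith 1 f) (a : ℕ → ℚ_[p]) (ha : IsMahlerCoeffs p f a) :
    (IsUnifDiffMod p 1 f ∧ unifDiffLevel p 1 f = 1) ↔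
      ((∀ s : ℕ, 1 ≤ s → ∀ c : ℕ, 2 ≤ c → c ≤ p - 1 → ∀ m : ℕ, m < p ^ s →
          PadicModEq p (s + 1) (a (m + c * p ^ s)) 0) ∧
        (∀ s : ℕ, 2 ≤ s → ∀ m : ℕ, m < p ^ s →
          PadicModEq p (s + 1) (a (m + p ^ s)) 0)) := by
  have hpp : p.Prime := Fact.out
  have hmod : ∀ m n, PadicModEq p m (a n) 0 ↔ (p : ℤ_[p]) ^ m ∣ (fwdDiff 1)^[n] f 0 :=
    fun m n => by
      rw [ha.eq_fwdDiff_iter hf.continuous, ← PadicInt.coe_zero, padicModEq_coe_iff, sub_zero]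
  simp only [isUnifDiffMod_and_level_eq_one_iff, unifDiffModWitness_one_iff hf, hmod]
  constructor
  · rintro ⟨D, hD⟩
    refine ⟨fun s hs c hc _ m _ => ?_, fun s hs m _ => ?_⟩
    · have h1 : p ≤ p ^ s := Nat.le_self_pow (by omega) p
      have h2 : 2 * p ^ s ≤ c * p ^ s := Nat.mul_le_mul_right _ hc
      exact hD.pow_dvd_fwdDiff_iter (by omega) (by omega)
    · have h1 : p ^ 2 ≤ p ^ s := Nat.pow_le_pow_right hpp.pos hs
      have h2 : 2 * p ≤ p ^ 2 := by nlinarith [hpp.two_le]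
      exact hD.pow_dvd_fwdDiff_iter (by omega) (by omega)
  · rintro ⟨h1, h2⟩
    refine exists_hasDerivModP_of_dvd (hasSum_fwdDiff_iter_mul_mahler hf.continuous) ?_ ?_
    · intro s n hs hn hsn
      have hn0 : n ≠ 0 := by have := hpp.pos; omega
      set t := Nat.log p n with ht
      have hst : s ≤ t := Nat.le_log_of_pow_le hpp.one_lt hsn
      have hlt : n < p ^ (t + 1) := Nat.lt_pow_succ_log_self hpp.one_lt n
      have hle : p ^ t ≤ n := Nat.pow_log_le_self p hn0
      have hpos : 0 < p ^ t := Nat.pow_pos hpp.pos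
      -- The leading base-`p` digit of `n` selects the condition; digit `1` with `n ≥ 2p` forces `t
      -- ≥ 2`.
      have hdm : n % p ^ t + n / p ^ t * p ^ t = n := Nat.mod_add_div' n _
      have hmlt := Nat.mod_lt n hpos
      have hc1 : 1 ≤ n / p ^ t := (Nat.one_le_div_iff hpos).2 hle
      have hc2 : n / p ^ t < p := Nat.div_lt_of_lt_mul (by rwa [pow_succ] at hlt)
      refine (pow_dvd_pow _ (by omega : s + 1 ≤ t + 1)).trans ?_
      rcases hc1.eq_or_lt with hc | hc
      · rw [← hc, one_mul] at hdm
        have ht2 : 2 ≤ t := by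
          by_contra! h
          have ht1 : t = 1 := by omega
          rw [ht1, pow_one] at hdm hmlt
          omega
        rw [← hdm]
        exact h2 t ht2 _ hmlt
      · rw [← hdm]
        exact h1 t (by omega) _ hc (by omega) _ hmlt
    · intro n hn
      have := PadicInt.pow_dvd_fwdDiff_iter (fun t x => pow_dvd_sub_of_lipschitzWith hf x dvd_rfl)
        (s := 1) (n := n) (by simpa using hn) 0
      simpa using this
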